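/- Let $d\ge 1$. A $d\times d$ real matrix $R$ is a *reflection nonsingular $\mathcal M$-matrix* if $R=I_d-Q$ with $Q\ge 0$ entrywise, zeros on the diagonal of $Q$, and spectral radius of $Q$ less than $1$. For continuous $X:[0,\infty)\to\mathbb R^d$ with $X(0)\ge 0$, a *solution of the Skorohod problem* in $\mathbb R^d_+$ with reflection matrix $R$ and driving function $X$ is a continuous $Z:[0,\infty)\to\mathbb R^d_+$ for which there is a continuous $L:[0,\infty)\to\mathbb R^d$ with $Z(t)=X(t)+RL(t)$ for all $t\ge 0$, and, for each $i$, $L_i(0)=0$, $L_i$ nondecreasing and $\int_0^\infty Z_i(t)\,dL_i(t)=0$. An $\mathrm{SRBM}^d(R,\mu,A)$ is an adapted process $Z$ on a filtered probability space satisfying the usual conditions which almost surely solves the Skorohod problem in $\mathbb R^d_+$ with reflection matrix $R$ and with driving function an $(\mathcal F_t)$-Brownian motion in $\mathbb R^d$ with drift vector $\mu$, covariance matrix $A$ and arbitrary initial distribution on $\mathbb R^d_+$. For $I=\{i_1<\dots<i_m\}\subseteq\{1,\dots,d\}$ put $[x]_I=(x_{i_1},\dots,x_{i_m})$ for $x\in\mathbb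 R^d$ and $[C]_I=(c_{i_ki_l})_{1\le k,l\le m}$ for a $d\times d$ matrix $C=(c_{ij})$. Vectors are compared componentwise. Let $R$ be a $d\times d$ reflection nonsingular $\mathcal M$-matrix, $A$ a $d\times d$ symmetric positive definite matrix, $\mu\in\mathbb R^d$, and $I\subseteq\{1,\dots,d\}$ nonempty. Let $Z$ be an $\mathrm{SRBM}^d(R,\mu,A)$ and let $\overline Z$ be an $\mathrm{SRBM}^{|I|}([R]_I,[\mu]_I,[A]_I)$, possibly on different probability spaces, such that $[Z(0)]_I$ has the same law as $\overline Z(0)$. Then $[Z]_I$ is stochastically dominated by $\overline Z$, that is, for every set $T\subseteq[0,\infty)$ of times and every function $y:T\to\mathbb R^{|I|}$, $$\mathbf P\big([Z(t)]_I\ge y(t)\ \text{for all } t\in T\big)\le \mathbf P\big(\overline Z(t)\ge y(t)\ \text{for all } t\in T\big).$$ In particular, $\mathbf P([Z(t)]_I\ge y)\le\mathbf P(\overline Z(t)\ge y)$ for every $t\ge 0$ and $y\in\mathbb R^{|I|}$. -/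

import Mathlib

open MeasureTheory ProbabilityTheory
open scoped NNReal ENNReal

noncomputable section

namespace SRBM

/-- `[x]_I = (x_{i₁}, …, x_{i_m})`, where `i₁ < … < i_m` are the elements of `I`. -/
def subVec {d : ℕ} (I : Finset (Fin d)) (x : Fin d → ℝ) : Fin I.card → ℝ :=
  fun k => x (I.orderEmbOfFin rfl k)

/-- `[C]_I = (c_{i_k i_l})`, the principal submatrix with rows and columns in `I`. -/
def subMat {d : ℕ} (I : Finset (Fin d)) (C : Matrix (Fin d) (Fin d) ℝ) :
    Matrix (Fin I.card) (Fin I.card) ℝ :=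
  C.submatrix (I.orderEmbOfFin rfl) (I.orderEmbOfFin rfl)

/-- `R` is a reflection nonsingular M-matrix: `R = 1 - Q` with `Q ≥ 0` entrywise, zeros on the
diagonal of `Q`, and spectral radius (over the complex numbers) of `Q` less than one. -/
def IsReflectionMMatrix {ι : Type*} [Fintype ι] [DecidableEq ι] (R : Matrix ι ι ℝ) : Prop :=
  ∃ Q : Matrix ι ι ℝ, R = 1 - Q ∧ (∀ i j, 0 ≤ Q i j) ∧ (∀ i, Q i i = 0) ∧
    spectralRadius ℂ (Q.map Complex.ofReal) < 1

/-- The Stieltjes measure `dℓ` on `[0, ∞)` of a continuous nondecreasing `ℓ : [0, ∞) → ℝ`;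
it has no atom at `0`. -/
def stieltjes (ℓ : ℝ≥0 → ℝ) (hm : Monotone ℓ) (hc : Continuous ℓ) : Measure ℝ≥0 :=
  (StieltjesFunction.mk ℓ hm fun _ => hc.continuousWithinAt).measure

/-- `L` is a vector of boundary terms showing that `Z` solves the Skorohod problem in the positive
orthant with reflection matrix `R` and driving function `X`. -/
structure IsSkorohodPair {ι : Type*} [Fintype ι] (R : Matrix ι ι ℝ)
    (X Z L : ℝ≥0 → ι → ℝ) : Prop where
  continuous_driving : Continuous X
  driving_zero_nonneg : 0 ≤ X 0
  continuous_sol : Continuous Z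
  nonneg : ∀ t, 0 ≤ Z t
  continuous_bdry : ∀ i, Continuous fun t => L t i
  eq_add : ∀ t, Z t = X t + R.mulVec (L t)
  bdry_zero : L 0 = 0
  mono_bdry : ∀ i, Monotone fun t => L t i
  /-- `∫₀^∞ Z_i(t) dL_i(t) = 0`; the integrand is nonnegative. -/
  integral_eq_zero : ∀ i, ∫⁻ t, ENNReal.ofReal (Z t i)
    ∂(stieltjes (fun t => L t i) (mono_bdry i) (continuous_bdry i)) = 0

/-- `Z` is a solution to the Skorohod problem in the positive orthant with reflection matrix `R`
and driving function `X`. -/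
def IsSkorohodSolution {ι : Type*} [Fintype ι] (R : Matrix ι ι ℝ)
    (X Z : ℝ≥0 → ι → ℝ) : Prop :=
  ∃ L : ℝ≥0 → ι → ℝ, IsSkorohodPair R X Z L

/-- The usual conditions: `𝓕` is right-continuous and `𝓕 0` contains all `P`-null sets. -/
structure UsualConditions {Ω : Type*} [mΩ : MeasurableSpace Ω] (P : Measure Ω)
    (𝓕 : Filtration ℝ≥0 mΩ) : Prop where
  right_cont : 𝓕.IsRightContinuous
  complete : ∀ N : Set Ω, P N = 0 → MeasurableSet[𝓕 0] N

/-- `B` is an `𝓕`-Brownian motion with drift vector `μ` and covariance matrix `A` (positive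
semidefinite) and arbitrary initial distribution: it is adapted, almost all paths are continuous,
and for `s ≤ t` the increment `B t - B s` is independent of `𝓕 s` and has the normal law
`N((t - s) μ, (t - s) A)`. -/
structure IsBrownianMotion {Ω : Type*} [mΩ : MeasurableSpace Ω] {ι : Type*} [Fintype ι]
    [DecidableEq ι] (P : Measure Ω) (𝓕 : Filtration ℝ≥0 mΩ) (μ : ι → ℝ) (A : Matrix ι ι ℝ)
    (B : ℝ≥0 → Ω → ι → ℝ) : Prop where
  adapted : ∀ t, Measurable[𝓕 t] (B t)
  continuous_paths : ∀ᵐ ω ∂P, Continuous fun t => B t ω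
  indep_increment : ∀ s t : ℝ≥0, s ≤ t →
    Indep (𝓕 s) (MeasurableSpace.comap (fun ω => B t ω - B s ω) inferInstance) P
  law_increment : ∀ s t : ℝ≥0, s ≤ t →
    HasLaw (fun ω => WithLp.toLp 2 (B t ω - B s ω))
      (multivariateGaussian (WithLp.toLp 2 (((t : ℝ) - s) • μ)) (((t : ℝ) - s) • A)) P

/-- `Z` is a semimartingale reflected Brownian motion in the positive orthant with reflection
matrix `R`, drift vector `μ` and covariance matrix `A`: on a filtered probability space satisfying
the usual conditions, `Z` is an adapted process which almost surely solves the Skorohod problem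
driven by some Brownian motion `B` with drift vector `μ` and covariance matrix `A`. -/
def IsSRBM {Ω : Type*} [mΩ : MeasurableSpace Ω] {ι : Type*} [Fintype ι] [DecidableEq ι]
    (P : Measure Ω) (R : Matrix ι ι ℝ) (μ : ι → ℝ) (A : Matrix ι ι ℝ)
    (Z : ℝ≥0 → Ω → ι → ℝ) : Prop :=
  ∃ (𝓕 : Filtration ℝ≥0 mΩ) (B : ℝ≥0 → Ω → ι → ℝ),
    UsualConditions P 𝓕 ∧ IsBrownianMotion P 𝓕 μ A B ∧ (∀ t, Measurable[𝓕 t] (Z t)) ∧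
      ∀ᵐ ω ∂P, IsSkorohodSolution R (fun t => B t ω) (fun t => Z t ω)

/-- Stochastic domination of random vectors (with finitely or infinitely many components `κ`):
`P(X ≥ y) ≤ P'(Y ≥ y)` for every `y`, where vectors are compared componentwise. -/
def StochDominated {Ω Ω' κ : Type*} [MeasurableSpace Ω] [MeasurableSpace Ω'] (P : Measure Ω)
    (P' : Measure Ω') (X : Ω → κ → ℝ) (Y : Ω' → κ → ℝ) : Prop :=
  ∀ y : κ → ℝ, P {ω | y ≤ X ω} ≤ P' {ω | y ≤ Y ω}

/-- Stochastic domination of processes: for every set `T` of times, the random vector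
`(V t i : t ∈ T, i ∈ ι)` is stochastically dominated by `(W t i : t ∈ T, i ∈ ι)`. For a one-point
set `T` this is stochastic domination of the values at a fixed time. -/
def ProcessStochDominated {Ω Ω' ι : Type*} [MeasurableSpace Ω] [MeasurableSpace Ω']
    (P : Measure Ω) (P' : Measure Ω') (V : ℝ≥0 → Ω → ι → ℝ) (W : ℝ≥0 → Ω' → ι → ℝ) : Prop :=
  ∀ T : Set ℝ≥0, StochDominated P P'
    (fun ω (p : T × ι) => V p.1 ω p.2) (fun ω (p : T × ι) => W p.1 ω p.2)

end SRBM

end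

/-!
The argument is a pathwise comparison followed by a transfer of laws.

Write `R = 1 - Q`. In a solution `Z = X + R L` of the Skorohod problem each `L i` is the boundary
term of a one-dimensional Skorohod problem driven by `X i - (Q L) i`, hence
`L i = regulator (X i - (Q L) i)` (`IsSkorohodPair.bdry_eq_regulator`). The one-dimensional
problem is monotone: if its driving function is lowered by a nondecreasing amount, the reflected path
goes down and the boundary term grows faster (`add_regulator_le_add_regulator`,
`regulator_sub_regulator_mono`).

For the components in `I`, let `pushIter` be the Picard iterates, started at zero, of the fixed point
equation with driving function `[X]_I` and matrix `[Q]_I`, and let `reflIter` be the corresponding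
reflected paths. Since `Q ≥ 0`, the components outside `I` only push `[Z]_I` further down, so
induction on the number of iterations and the monotonicity above give `[Z]_I ≤ reflIter n` for every
`n` (`sol_le_reflIter`). Existence of a solution for the subsystem on the space of `Z` is not needed.

On the other hand, the iterates converge to every solution of the Skorohod problem of the subsystem:
the error after `n` steps is at most `[Q]_I ^ n` applied to a fixed vector, and these powers vanish
because they are entrywise at most those of `Q` and `Q` has spectral radius less than one
(`tendsto_reflIter`, `tendsto_submatrix_pow`).

The path `[B]_I` of the Brownian motion driving `Z` has the law of the Brownian motion driving the
other process (`IsBrownianMotion.identDistrib_comp`), and `reflIter` is a measurable functional of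
the path, as its suprema run over countable sets of times. Therefore the event that all the iterates
exceed `y` has the same probability on both spaces; it contains `{[Z]_I ≥ y}` almost surely on the
first space and is contained in the event for the dominating process on the second. An uncountable
set of times is reduced to a countable one by `exists_countable_forall_le`.
-/

namespace SRBM

open Filter Topology

/-! ### The one-dimensional regulator -/

/-- The regulator `t ↦ sup_{s ≤ t} (f s)⁻` of the one-dimensional Skorohod problem. The supremum
runs over the times `min q t` with `q` in a countable dense set, which makes `regulator f t` a
measurable function of `f`; for continuous `f` it is the supremum over all `s ≤ t`. -/
noncomputable def regulator (f : ℝ≥0 → ℝ) (t : ℝ≥0) : ℝ :=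
  ⨆ n : ℕ, max 0 (-f (min (TopologicalSpace.denseSeq ℝ≥0 n) t))

lemma regulator_le {f : ℝ≥0 → ℝ} {t : ℝ≥0} {c : ℝ} (hc : 0 ≤ c) (h : ∀ s ≤ t, -f s ≤ c) :
    regulator f t ≤ c :=
  ciSup_le fun _ => max_le hc (h _ (min_le_right _ _))

lemma max_zero_neg_le_regulator {f : ℝ≥0 → ℝ} (hf : Continuous f) {s t : ℝ≥0} (hst : s ≤ t) :
    max 0 (-f s) ≤ regulator f t := by
  have hcont : Continuous fun c => max 0 (-f (min c t)) := by fun_prop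
  have hbdd : BddAbove (Set.range fun n : ℕ =>
      max 0 (-f (min (TopologicalSpace.denseSeq ℝ≥0 n) t))) := by
    obtain ⟨C, hC⟩ := (isCompact_Icc (a := (0 : ℝ≥0)) (b := t)).bddAbove_image
      (f := fun c => max 0 (-f c)) (by fun_prop)
    refine ⟨C, ?_⟩
    rintro _ ⟨n, rfl⟩
    exact hC ⟨_, ⟨zero_le, min_le_right _ _⟩, rfl⟩
  have hclosed : IsClosed {c : ℝ≥0 | max 0 (-f (min c t)) ≤ regulator f t} :=
    isClosed_le hcont continuous_const
  have hmem : ∀ c, max 0 (-f (min c t)) ≤ regulator f t := fun c =>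
    (TopologicalSpace.denseRange_denseSeq ℝ≥0).induction_on c hclosed
      fun n => le_ciSup hbdd n
  simpa [min_eq_left hst] using hmem s

lemma neg_le_regulator {f : ℝ≥0 → ℝ} (hf : Continuous f) {s t : ℝ≥0} (hst : s ≤ t) :
    -f s ≤ regulator f t :=
  (le_max_right _ _).trans (max_zero_neg_le_regulator hf hst)

lemma regulator_nonneg {f : ℝ≥0 → ℝ} (hf : Continuous f) (t : ℝ≥0) : 0 ≤ regulator f t :=
  (le_max_left _ _).trans (max_zero_neg_le_regulator hf le_rfl)

lemma regulator_mono {f : ℝ≥0 → ℝ} (hf : Continuous f) : Monotone (regulator f) := fun _ t hst =>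
  regulator_le (regulator_nonneg hf t) fun _ hr => neg_le_regulator hf (hr.trans hst)

lemma continuous_regulator {f : ℝ≥0 → ℝ} (hf : Continuous f) : Continuous (regulator f) := by
  -- Rescaling time turns the supremum over `[0, t]` into one over the fixed compact set `[0, 1]`.
  have hjoint : Continuous ↿(fun (t c : ℝ≥0) => max 0 (-f (c * t))) := by
    simp only [Function.HasUncurry.uncurry, id]
    fun_prop
  have key := (isCompact_Icc (a := (0 : ℝ≥0)) (b := 1)).continuous_sSup hjoint
  convert key using 2 with t
  have hlub : IsLUB ((fun c : ℝ≥0 => max 0 (-f (c * t))) '' Set.Icc 0 1) (regulator f t) := by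
    constructor
    · rintro _ ⟨c, hc, rfl⟩
      exact max_zero_neg_le_regulator hf (mul_le_of_le_one_left zero_le hc.2)
    · intro b hb
      have hb0 : 0 ≤ b := (le_max_left _ _).trans (hb ⟨0, by simp, rfl⟩)
      refine regulator_le hb0 fun s hs => ?_
      rcases eq_or_ne t 0 with rfl | ht
      · obtain rfl : s = 0 := le_antisymm hs zero_le
        exact (le_max_right 0 _).trans (hb ⟨0, by simp, by simp⟩)
      · refine (le_max_right 0 _).trans (hb ⟨s / t, ⟨zero_le, ?_⟩, ?_⟩)
        · exact div_le_one_of_le₀ hs zero_le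
        · simp only [div_mul_cancel₀ s ht]
  exact (hlub.csSup_eq ⟨_, 0, by simp, rfl⟩).symm

lemma regulator_sub_le {f g : ℝ≥0 → ℝ} (hg : Continuous g) {t : ℝ≥0} {c : ℝ}
    (h : ∀ s ≤ t, |f s - g s| ≤ c) : regulator f t ≤ regulator g t + c := by
  have hc : 0 ≤ c := (abs_nonneg _).trans (h 0 zero_le)
  refine regulator_le (add_nonneg (regulator_nonneg hg t) hc) fun s hs => ?_
  have h1 := neg_le_regulator hg hs
  have h2 := abs_le.1 (h s hs)
  linarith

lemma abs_regulator_sub_le {f g : ℝ≥0 → ℝ} (hf : Continuous f) (hg : Continuous g) {t : ℝ≥0}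
    {c : ℝ} (h : ∀ s ≤ t, |f s - g s| ≤ c) : |regulator f t - regulator g t| ≤ c := by
  have h1 := regulator_sub_le hg h
  have h2 := regulator_sub_le hf fun s hs => (abs_sub_comm (g s) (f s)).trans_le (h s hs)
  exact abs_le.2 ⟨by linarith, by linarith⟩

/-- If `g` falls below `f` by a nondecreasing amount, the reflected path of `g` stays below the
reflected path of `f`. -/
lemma add_regulator_le_add_regulator {f g : ℝ≥0 → ℝ} (hf : Continuous f)
    (h0 : g 0 ≤ f 0) (hfg : Monotone fun t => f t - g t) (t : ℝ≥0) :
    g t + regulator g t ≤ f t + regulator f t := by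
  have hpos : f 0 - g 0 ≤ f t - g t := hfg zero_le
  have hreg := regulator_nonneg hf t
  have : regulator g t ≤ f t + regulator f t - g t := by
    refine regulator_le (by linarith) fun s hs => ?_
    have h1 : f s - g s ≤ f t - g t := hfg hs
    have h2 := neg_le_regulator hf hs
    linarith
  linarith

/-- If `g` falls below `f` by a nondecreasing amount, then on every time interval `g` is pushed at
least as much as `f`. -/
lemma regulator_sub_regulator_mono {f g : ℝ≥0 → ℝ} (hf : Continuous f) (hg : Continuous g)
    (h0 : g 0 ≤ f 0) (hfg : Monotone fun t => f t - g t) :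
    Monotone fun t => regulator g t - regulator f t := by
  intro s t hst
  have hmono := regulator_mono hg hst
  have : regulator f t ≤ regulator f s + (regulator g t - regulator g s) := by
    refine regulator_le (by linarith [regulator_nonneg hf s]) fun u hu => ?_
    rcases le_total u s with hus | hsu
    · linarith [neg_le_regulator hf hus]
    · have hle : regulator g s ≤ regulator f s + (f u - g u) := by
        have hu0 : f 0 - g 0 ≤ f u - g u := hfg zero_le
        refine regulator_le (by linarith [regulator_nonneg hf s]) fun v hv => ?_
        have h1 : f v - g v ≤ f u - g u := hfg (hv.trans hsu)
        linarith [neg_le_regulator hf hv]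
      linarith [neg_le_regulator hg hu]
  simp only
  linarith

/-- The pushing term of a one-dimensional Skorohod problem is the regulator of its driving
function: between the last time before `t` at which `l` is at most `regulator x t` and the time `t`
itself, `x + l` would be positive although `l` increases. -/
lemma eq_regulator_of_lintegral_eq_zero {x l : ℝ≥0 → ℝ} (hx : Continuous x) (hm : Monotone l)
    (hc : Continuous l) (h0 : l 0 = 0) (hz : ∀ t, 0 ≤ x t + l t)
    (hint : ∫⁻ t, ENNReal.ofReal (x t + l t) ∂(stieltjes l hm hc) = 0) (t : ℝ≥0) :
    l t = regulator x t := by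
  refine le_antisymm ?_ ?_
  · by_contra! hlt
    let S : Set ℝ≥0 := {s | s ≤ t ∧ l s ≤ regulator x t}
    have hS0 : (0 : ℝ≥0) ∈ S := ⟨zero_le, by rw [h0]; exact regulator_nonneg hx t⟩
    have hSb : BddAbove S := ⟨t, fun s hs => hs.1⟩
    have hScl : IsClosed S :=
      (isClosed_le continuous_id continuous_const).inter (isClosed_le hc continuous_const)
    obtain ⟨hσt, hσ⟩ : sSup S ∈ S := hScl.csSup_mem ⟨0, hS0⟩ hSb
    have hpos : ∀ u ∈ Set.Ioc (sSup S) t, 0 < x u + l u := by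
      rintro u ⟨hu1, hu2⟩
      have h1 : regulator x t < l u := by
        by_contra! hle
        exact (le_csSup hSb ⟨hu2, hle⟩).not_gt hu1
      linarith [neg_le_regulator hx hu2]
    have hmeas : Measurable fun t => ENNReal.ofReal (x t + l t) :=
      ((hx.add hc).measurable).ennreal_ofReal
    have hae := (lintegral_eq_zero_iff hmeas).1 hint
    have hzero : stieltjes l hm hc (Set.Ioc (sSup S) t) = 0 := by
      refine measure_mono_null ?_ (ae_iff.1 hae)
      intro u hu
      simpa using hpos u hu
    have hval : stieltjes l hm hc (Set.Ioc (sSup S) t) = ENNReal.ofReal (l t - l (sSup S)) :=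
      StieltjesFunction.measure_Ioc _ _ _
    rw [hval, ENNReal.ofReal_eq_zero] at hzero
    linarith
  · refine regulator_le (h0 ▸ hm zero_le) fun s hs => ?_
    linarith [hz s, hm hs]

/-! ### Powers of the matrix `Q` -/

/-- Powers of a matrix of spectral radius less than one tend to zero, by Gelfand's formula. -/
lemma tendsto_pow_of_spectralRadius_lt_one {ι : Type*} [Fintype ι] [DecidableEq ι]
    {Q : Matrix ι ι ℝ} (hQ : spectralRadius ℂ (Q.map Complex.ofReal) < 1) (i j : ι) :
    Tendsto (fun n : ℕ => (Q ^ n) i j) atTop (𝓝 0) := by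
  let _ : NormedRing (Matrix ι ι ℂ) := Matrix.linftyOpNormedRing
  let _ : NormedAlgebra ℂ (Matrix ι ι ℂ) := Matrix.linftyOpNormedAlgebra
  have : CompleteSpace (Matrix ι ι ℂ) := FiniteDimensional.complete ℂ _
  set M : Matrix ι ι ℂ := Q.map Complex.ofReal with hM
  obtain ⟨r, hr1, hr2⟩ := ENNReal.lt_iff_exists_nnreal_btwn.1 hQ
  have hr : r < 1 := by exact_mod_cast hr2
  have hev := (spectrum.gelfand_formula M).eventually_lt_const hr1
  have hnorm : Tendsto (fun n : ℕ => ‖M ^ n‖₊) atTop (𝓝 0) := by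
    refine tendsto_of_tendsto_of_tendsto_of_le_of_le' tendsto_const_nhds
      (NNReal.tendsto_pow_atTop_nhds_zero_of_lt_one hr)
      (Eventually.of_forall fun _ => zero_le) ?_
    filter_upwards [hev, eventually_gt_atTop 0] with n hn hn0
    have h1 := ENNReal.rpow_le_rpow hn.le (z := (n : ℝ)) (by positivity)
    rw [← ENNReal.rpow_mul, one_div, inv_mul_cancel₀ (by positivity), ENNReal.rpow_one,
      ENNReal.rpow_natCast] at h1
    exact_mod_cast h1
  have hpow : Tendsto (fun n : ℕ => M ^ n) atTop (𝓝 0) := by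
    have hnorm' : Tendsto (fun n : ℕ => ‖M ^ n‖) atTop (𝓝 0) := by
      simpa using NNReal.tendsto_coe.2 hnorm
    exact tendsto_zero_iff_norm_tendsto_zero.2 hnorm'
  have hent : Tendsto (fun n : ℕ => (M ^ n) i j) atTop (𝓝 0) :=
    ((continuous_id.matrix_elem i j).tendsto (0 : Matrix ι ι ℂ)).comp hpow
  have hre := (Complex.continuous_re.tendsto _).comp hent
  simp only [Complex.zero_re] at hre
  refine hre.congr fun n => ?_
  have : M ^ n = (Q ^ n).map Complex.ofReal := (Matrix.map_pow Q Complex.ofRealHom n).symm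
  simp [this]

lemma pow_apply_nonneg {ι : Type*} [Fintype ι] [DecidableEq ι] {Q : Matrix ι ι ℝ}
    (hQ : ∀ i j, 0 ≤ Q i j) (n : ℕ) (i j : ι) : 0 ≤ (Q ^ n) i j := by
  induction n generalizing i j with
  | zero => rw [pow_zero, Matrix.one_apply]; split_ifs <;> norm_num
  | succ n ih =>
    rw [pow_succ, Matrix.mul_apply]
    exact Finset.sum_nonneg fun k _ => mul_nonneg (ih i k) (hQ k j)

lemma sum_comp_le_sum {κ ι : Type*} [Fintype κ] [Fintype ι] {e : κ → ι}
    (he : Function.Injective e) {g : ι → ℝ} (hg : ∀ i, 0 ≤ g i) :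
    ∑ k, g (e k) ≤ ∑ i, g i := by
  change ∑ k, g ((⟨e, he⟩ : κ ↪ ι) k) ≤ _
  rw [← Finset.sum_map Finset.univ ⟨e, he⟩ g]
  exact Finset.sum_le_sum_of_subset_of_nonneg (Finset.subset_univ _) fun i _ _ => hg i

lemma submatrix_pow_le {κ ι : Type*} [Fintype κ] [Fintype ι] [DecidableEq κ] [DecidableEq ι]
    {Q : Matrix ι ι ℝ} (hQ : ∀ i j, 0 ≤ Q i j) {e : κ → ι} (he : Function.Injective e) (n : ℕ)
    (k l : κ) : (Q.submatrix e e ^ n) k l ≤ (Q ^ n) (e k) (e l) := by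
  induction n generalizing k l with
  | zero => simp [Matrix.one_apply, he.eq_iff]
  | succ n ih =>
    rw [pow_succ, pow_succ, Matrix.mul_apply, Matrix.mul_apply]
    calc ∑ m, (Q.submatrix e e ^ n) k m * Q.submatrix e e m l
        ≤ ∑ m, (Q ^ n) (e k) (e m) * Q (e m) (e l) :=
          Finset.sum_le_sum fun m _ => mul_le_mul_of_nonneg_right (ih k m) (hQ _ _)
      _ ≤ _ := sum_comp_le_sum he (g := fun j => (Q ^ n) (e k) j * Q j (e l))
          fun j => mul_nonneg (pow_apply_nonneg hQ _ _ _) (hQ _ _)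

lemma tendsto_submatrix_pow {κ ι : Type*} [Fintype κ] [Fintype ι] [DecidableEq κ]
    [DecidableEq ι] {Q : Matrix ι ι ℝ} (hQ : ∀ i j, 0 ≤ Q i j)
    (hsp : spectralRadius ℂ (Q.map Complex.ofReal) < 1) {e : κ → ι} (he : Function.Injective e)
    (k l : κ) : Tendsto (fun n : ℕ => (Q.submatrix e e ^ n) k l) atTop (𝓝 0) :=
  tendsto_of_tendsto_of_tendsto_of_le_of_le tendsto_const_nhds
    (tendsto_pow_of_spectralRadius_lt_one hsp (e k) (e l))
    (fun n => pow_apply_nonneg (fun _ _ => hQ _ _) n k l) fun n => submatrix_pow_le hQ he n k l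

/-! ### Successive approximation of the Skorohod problem -/

section Iteration

variable {ι : Type*} [Fintype ι]

/-- Picard iterates, started at zero, for the boundary term of the Skorohod problem with
reflection matrix `1 - Q` and driving function `x`. -/
noncomputable def pushIter (Q : Matrix ι ι ℝ) (x : ℝ≥0 → ι → ℝ) : ℕ → ℝ≥0 → ι → ℝ
  | 0 => 0
  | n + 1 => fun t i => regulator (fun s => x s i - Q.mulVec (pushIter Q x n s) i) t

/-- The reflected path belonging to the boundary terms `pushIter`. Its component `i` is obtained
by reflecting at zero the path `x · i`, pushed down by the other components. -/
noncomputable def reflIter (Q : Matrix ι ι ℝ) (x : ℝ≥0 → ι → ℝ) (n : ℕ) (t : ℝ≥0) (i : ι) : ℝ :=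
  x t i - Q.mulVec (pushIter Q x n t) i + pushIter Q x (n + 1) t i

lemma continuous_sub_mulVec (Q : Matrix ι ι ℝ) {x L : ℝ≥0 → ι → ℝ} (hx : Continuous x)
    (hL : ∀ i, Continuous fun t => L t i) (i : ι) :
    Continuous fun t => x t i - Q.mulVec (L t) i := by
  have hL' : Continuous L := continuous_pi hL
  have : Continuous fun t => Q.mulVec (L t) := continuous_const.matrix_mulVec hL'
  fun_prop

lemma continuous_pushIter (Q : Matrix ι ι ℝ) {x : ℝ≥0 → ι → ℝ} (hx : Continuous x) (n : ℕ)
    (i : ι) : Continuous fun t => pushIter Q x n t i := by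
  induction n generalizing i with
  | zero => exact continuous_const
  | succ n ih => exact continuous_regulator (continuous_sub_mulVec Q hx ih i)

lemma pushIter_apply_zero (Q : Matrix ι ι ℝ) {x : ℝ≥0 → ι → ℝ} (hx : Continuous x)
    (h0 : 0 ≤ x 0) (n : ℕ) : pushIter Q x n 0 = 0 := by
  induction n with
  | zero => rfl
  | succ n ih =>
    ext i
    simp only [pushIter, Pi.zero_apply]
    refine le_antisymm (regulator_le le_rfl fun s hs => ?_) (regulator_nonneg
      (continuous_sub_mulVec Q hx (continuous_pushIter Q hx n) i) 0)
    obtain rfl : s = 0 := le_antisymm hs zero_le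
    simpa [ih] using h0 i

lemma measurable_regulator {α : Type*} [MeasurableSpace α] {f : α → ℝ≥0 → ℝ}
    (hf : ∀ t, Measurable fun a => f a t) (t : ℝ≥0) : Measurable fun a => regulator (f a) t :=
  Measurable.iSup fun _ => measurable_const.max (hf _).neg

lemma measurable_mulVec (Q : Matrix ι ι ℝ) {α : Type*} [MeasurableSpace α] {v : α → ι → ℝ}
    (hv : ∀ i, Measurable fun a => v a i) (i : ι) : Measurable fun a => Q.mulVec (v a) i :=
  Finset.measurable_sum _ fun j _ => (hv j).const_mul _

lemma measurable_pushIter (Q : Matrix ι ι ℝ) (n : ℕ) (t : ℝ≥0) (i : ι) :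
    Measurable fun x : ℝ≥0 → ι → ℝ => pushIter Q x n t i := by
  induction n generalizing t i with
  | zero => exact measurable_const
  | succ n ih =>
    have hx (s : ℝ≥0) : Measurable fun x : ℝ≥0 → ι → ℝ => x s i := by fun_prop
    exact measurable_regulator
      (f := fun (x : ℝ≥0 → ι → ℝ) s => x s i - Q.mulVec (pushIter Q x n s) i)
      (fun s => (hx s).sub (measurable_mulVec Q (ih s) i)) t

lemma measurable_reflIter (Q : Matrix ι ι ℝ) (n : ℕ) (t : ℝ≥0) (i : ι) :
    Measurable fun x : ℝ≥0 → ι → ℝ => reflIter Q x n t i :=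
  (Measurable.sub (by fun_prop) (measurable_mulVec Q (fun j => measurable_pushIter Q n t j) i)).add
    (measurable_pushIter Q (n + 1) t i)

section Convergence

variable [DecidableEq ι] {Q : Matrix ι ι ℝ} {X Z L : ℝ≥0 → ι → ℝ}

lemma IsSkorohodPair.sol_apply (h : IsSkorohodPair (1 - Q) X Z L) (t : ℝ≥0) (i : ι) :
    Z t i = X t i - Q.mulVec (L t) i + L t i := by
  rw [h.eq_add t, Matrix.sub_mulVec, Matrix.one_mulVec]
  simp only [Pi.add_apply, Pi.sub_apply]
  ring

lemma IsSkorohodPair.bdry_eq_regulator (h : IsSkorohodPair (1 - Q) X Z L) (t : ℝ≥0) (i : ι) :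
    L t i = regulator (fun s => X s i - Q.mulVec (L s) i) t := by
  refine eq_regulator_of_lintegral_eq_zero
    (continuous_sub_mulVec Q h.continuous_driving h.continuous_bdry i) (h.mono_bdry i)
    (h.continuous_bdry i) (by simp [h.bdry_zero]) (fun s => ?_) ?_ t
  · rw [← h.sol_apply]; exact h.nonneg s i
  · simp_rw [← h.sol_apply]; exact h.integral_eq_zero i

/-- The regulator is 1-Lipschitz for the supremum norm on `[0, t]`, so each iteration multiplies a
componentwise bound on the error by `Q`. -/
lemma abs_pushIter_sub_le (hQ : ∀ i j, 0 ≤ Q i j) (h : IsSkorohodPair (1 - Q) X Z L) (n : ℕ)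
    {s t : ℝ≥0} (hst : s ≤ t) (i : ι) :
    |pushIter Q X n s i - L s i| ≤ (Q ^ n).mulVec (L t) i := by
  induction n generalizing s i with
  | zero =>
    have h0 : 0 ≤ L s i := by
      have := h.mono_bdry i (zero_le : 0 ≤ s)
      simpa [h.bdry_zero] using this
    have h1 : L s i ≤ L t i := h.mono_bdry i hst
    simpa [pushIter, abs_of_nonneg h0] using h1
  | succ n ih =>
    rw [h.bdry_eq_regulator s i, pow_succ', ← Matrix.mulVec_mulVec]
    refine abs_regulator_sub_le
      (continuous_sub_mulVec Q h.continuous_driving (continuous_pushIter Q h.continuous_driving n) i)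
      (continuous_sub_mulVec Q h.continuous_driving h.continuous_bdry i) fun r hr => ?_
    have : X r i - Q.mulVec (pushIter Q X n r) i - (X r i - Q.mulVec (L r) i)
        = -∑ j, Q i j * (pushIter Q X n r j - L r j) := by
      simp only [Matrix.mulVec, dotProduct, mul_sub, Finset.sum_sub_distrib]
      ring
    rw [this, abs_neg]
    refine (Finset.abs_sum_le_sum_abs _ _).trans (Finset.sum_le_sum fun j _ => ?_)
    rw [abs_mul, abs_of_nonneg (hQ i j)]
    exact mul_le_mul_of_nonneg_left (ih (hr.trans hst) j) (hQ i j)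

lemma tendsto_pushIter (hQ : ∀ i j, 0 ≤ Q i j)
    (hpow : ∀ i j, Tendsto (fun n : ℕ => (Q ^ n) i j) atTop (𝓝 0))
    (h : IsSkorohodPair (1 - Q) X Z L) (t : ℝ≥0) (i : ι) :
    Tendsto (fun n => pushIter Q X n t i) atTop (𝓝 (L t i)) := by
  have hlim : Tendsto (fun n : ℕ => (Q ^ n).mulVec (L t) i) atTop (𝓝 0) := by
    simpa [Matrix.mulVec, dotProduct] using
      tendsto_finsetSum Finset.univ fun j _ => (hpow i j).mul_const (L t j)
  rw [tendsto_iff_norm_sub_tendsto_zero]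
  exact squeeze_zero (fun _ => norm_nonneg _) (fun n => abs_pushIter_sub_le hQ h n le_rfl i) hlim

/-- The approximations converge to the solution of the Skorohod problem; in particular the solution
is a functional of the driving function. -/
lemma tendsto_reflIter (hQ : ∀ i j, 0 ≤ Q i j)
    (hpow : ∀ i j, Tendsto (fun n : ℕ => (Q ^ n) i j) atTop (𝓝 0))
    (h : IsSkorohodPair (1 - Q) X Z L) (t : ℝ≥0) (i : ι) :
    Tendsto (fun n => reflIter Q X n t i) atTop (𝓝 (Z t i)) := by
  rw [h.sol_apply]
  have hlim := tendsto_pushIter hQ hpow h t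
  have hsum : Tendsto (fun n => Q.mulVec (pushIter Q X n t) i) atTop (𝓝 (Q.mulVec (L t) i)) :=
    tendsto_finsetSum _ fun j _ => (hlim j).const_mul _
  exact (hsum.const_sub _).add ((tendsto_add_atTop_iff_nat 1).2 (hlim i))

end Convergence

/-! ### Comparison of a solution with the subsystem -/

variable {κ : Type*} [Fintype κ] {e : κ → ι}

/-- The components outside the range of `e` only push the subsystem down, so the driving
functions of the one-dimensional problems differ by a nondecreasing function. -/
lemma monotone_mulVec_sub_mulVec {Q : Matrix ι ι ℝ}
    (hQ : ∀ i j, 0 ≤ Q i j) (he : Function.Injective e) {L : ℝ≥0 → ι → ℝ}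
    (hL : ∀ i, Monotone fun t => L t i) {M : ℝ≥0 → κ → ℝ}
    (hLM : ∀ k, Monotone fun t => L t (e k) - M t k) (k : κ) :
    Monotone fun t => Q.mulVec (L t) (e k) - (Q.submatrix e e).mulVec (M t) k := by
  intro s t hst
  have h1 : ∑ l, Q (e k) (e l) * (M t l - M s l) ≤ ∑ l, Q (e k) (e l) * (L t (e l) - L s (e l)) :=
    Finset.sum_le_sum fun l _ => mul_le_mul_of_nonneg_left
      (by have := hLM l hst; simp only at this; linarith) (hQ _ _)
  have h2 : ∑ l, Q (e k) (e l) * (L t (e l) - L s (e l)) ≤ ∑ j, Q (e k) j * (L t j - L s j) :=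
    sum_comp_le_sum he (g := fun j => Q (e k) j * (L t j - L s j)) fun j =>
      mul_nonneg (hQ _ _) (sub_nonneg.2 (hL j hst))
  have h3 := h1.trans h2
  simp only [mul_sub, Finset.sum_sub_distrib] at h3
  simp only [Matrix.mulVec, dotProduct, Matrix.submatrix_apply]
  linarith

variable [DecidableEq ι] {Q : Matrix ι ι ℝ} {X Z L : ℝ≥0 → ι → ℝ}

/-- The subsystem is pushed at most as much by its Picard iterates as it is by the solution of the
whole system. -/
lemma monotone_bdry_sub_pushIter [DecidableEq κ] (hQ : ∀ i j, 0 ≤ Q i j)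
    (he : Function.Injective e) (h : IsSkorohodPair (1 - Q) X Z L) (n : ℕ) (k : κ) :
    Monotone fun t => L t (e k) - pushIter (Q.submatrix e e) (fun s l => X s (e l)) n t k := by
  induction n generalizing k with
  | zero => simpa [pushIter] using h.mono_bdry (e k)
  | succ n ih =>
    have hX := h.continuous_driving
    have hXe : Continuous fun s l => X s (e l) := by fun_prop
    simp only [h.bdry_eq_regulator, pushIter]
    refine regulator_sub_regulator_mono
      (continuous_sub_mulVec _ hXe (continuous_pushIter _ hXe n) k)
      (continuous_sub_mulVec Q hX h.continuous_bdry (e k)) ?_ ?_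
    · simp [h.bdry_zero, pushIter_apply_zero _ hXe fun l => h.driving_zero_nonneg (e l)]
    · simpa only [sub_sub_sub_cancel_left] using
        monotone_mulVec_sub_mulVec hQ he h.mono_bdry ih k

/-- A subsystem of a solution of the Skorohod problem lies below the approximate solutions of the
Skorohod problem for the subsystem. -/
lemma sol_le_reflIter [DecidableEq κ] (hQ : ∀ i j, 0 ≤ Q i j)
    (he : Function.Injective e) (h : IsSkorohodPair (1 - Q) X Z L) (n : ℕ) (t : ℝ≥0) (k : κ) :
    Z t (e k) ≤ reflIter (Q.submatrix e e) (fun s l => X s (e l)) n t k := by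
  have hX := h.continuous_driving
  have hXe : Continuous fun s l => X s (e l) := by fun_prop
  rw [h.sol_apply, h.bdry_eq_regulator t (e k)]
  refine add_regulator_le_add_regulator
    (f := fun s => X s (e k) -
      (Q.submatrix e e).mulVec (pushIter (Q.submatrix e e) (fun s l => X s (e l)) n s) k)
    (g := fun s => X s (e k) - Q.mulVec (L s) (e k))
    (continuous_sub_mulVec _ hXe (continuous_pushIter _ hXe n) k) ?_ ?_ t
  · simp [h.bdry_zero, pushIter_apply_zero _ hXe fun l => h.driving_zero_nonneg (e l)]
  · simpa only [sub_sub_sub_cancel_left] using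
      monotone_mulVec_sub_mulVec hQ he h.mono_bdry (monotone_bdry_sub_pushIter hQ he h n) k

end Iteration

/-! ### The law of a process with independent increments -/

section IncrementLaw

variable {Ω Ω' E : Type*} [mΩ : MeasurableSpace Ω] [mΩ' : MeasurableSpace Ω'] {P : Measure Ω}
  {P' : Measure Ω'} [AddCommGroup E] [MeasurableSpace E] {𝓕 : Filtration ℝ≥0 mΩ}
  {𝓕' : Filtration ℝ≥0 mΩ'}
  {W : ℝ≥0 → Ω → E} {W' : ℝ≥0 → Ω' → E}

lemma indepFun_stopped_increment (hW : ∀ t, Measurable[𝓕 t] (W t))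
    (hind : ∀ s t : ℝ≥0, s ≤ t →
      Indep (𝓕 s) (MeasurableSpace.comap (fun ω => W t ω - W s ω) inferInstance) P)
    {τ : ℕ → ℝ≥0} (hτ : Monotone τ) (n : ℕ) :
    IndepFun (fun ω k => W (τ (min k n)) ω) (fun ω => W (τ (n + 1)) ω - W (τ n) ω) P := by
  have hmeas : Measurable[𝓕 (τ n)] fun ω (k : ℕ) => W (τ (min k n)) ω :=
    @measurable_pi_lambda Ω ℕ (fun _ => E) (𝓕 (τ n)) _ _ fun k =>
      (hW _).mono (𝓕.mono (hτ (min_le_right k n))) le_rfl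
  exact indep_of_indep_of_le_left (hind _ _ (hτ n.le_succ)) (measurable_iff_comap_le.1 hmeas)

variable [IsProbabilityMeasure P] [MeasurableAdd₂ E]

/-- Equality in law along a sequence of times: the path up to time `τ (n + 1)` is a function of the
path up to time `τ n` and of an independent increment. -/
lemma identDistrib_stopped (hW : ∀ t, Measurable[𝓕 t] (W t)) (hW' : ∀ t, Measurable[𝓕' t] (W' t))
    (hind : ∀ s t : ℝ≥0, s ≤ t →
      Indep (𝓕 s) (MeasurableSpace.comap (fun ω => W t ω - W s ω) inferInstance) P)
    (hind' : ∀ s t : ℝ≥0, s ≤ t →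
      Indep (𝓕' s) (MeasurableSpace.comap (fun ω => W' t ω - W' s ω) inferInstance) P')
    (h0 : IdentDistrib (W 0) (W' 0) P P')
    (hinc : ∀ s t : ℝ≥0, s ≤ t →
      IdentDistrib (fun ω => W t ω - W s ω) (fun ω => W' t ω - W' s ω) P P')
    {τ : ℕ → ℝ≥0} (hτ : Monotone τ) (hτ0 : τ 0 = 0) (n : ℕ) :
    IdentDistrib (fun ω k => W (τ (min k n)) ω) (fun ω k => W' (τ (min k n)) ω) P P' := by
  induction n with
  | zero =>
    have := h0.comp (u := fun (x : E) (_ : ℕ) => x) (by fun_prop)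
    simpa [hτ0, Function.comp_def] using this
  | succ n ih =>
    have hpair := ih.prodMk (hinc _ _ (hτ n.le_succ)) (indepFun_stopped_increment hW hind hτ n)
      (indepFun_stopped_increment hW' hind' hτ n)
    let u : (ℕ → E) × E → ℕ → E := fun p k => if k ≤ n then p.1 k else p.1 n + p.2
    have hu : Measurable u := by
      refine measurable_pi_iff.2 fun k => ?_
      by_cases hk : k ≤ n
      · simp only [u, hk, if_true]; fun_prop
      · simp only [u, hk, if_false]; fun_prop
    convert hpair.comp hu using 1 <;>
    · ext ω k
      by_cases hk : k ≤ n
      · simp [u, hk, hk.trans n.le_succ]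
      · simp [u, hk, Nat.succ_le_of_lt (not_le.1 hk)]

lemma exists_monotone_seq_mem (S : Finset ℝ≥0) :
    ∃ (τ : ℕ → ℝ≥0) (n : ℕ), Monotone τ ∧ τ 0 = 0 ∧ ∀ s ∈ S, ∃ k ≤ n, τ k = s := by
  classical
  let S' := insert 0 S
  have hpos : 0 < S'.card := Finset.card_pos.2 ⟨0, Finset.mem_insert_self _ _⟩
  let f := S'.orderEmbOfFin rfl
  have hlt (k : ℕ) : min k (S'.card - 1) < S'.card := by omega
  have hf (s : ℝ≥0) (hs : s ∈ S') : ∃ k ≤ S'.card - 1, f ⟨_, hlt k⟩ = s := by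
    obtain ⟨j, rfl⟩ : s ∈ Set.range f := by rw [Finset.range_orderEmbOfFin]; exact hs
    have hj : (j : ℕ) ≤ S'.card - 1 := by omega
    exact ⟨j, hj, by simp [hj]⟩
  have hmono : Monotone fun k => f ⟨_, hlt k⟩ := fun a b hab =>
    f.monotone (min_le_min_right _ hab)
  refine ⟨fun k => f ⟨_, hlt k⟩, S'.card - 1, hmono, ?_, fun s hs =>
    hf s (Finset.mem_insert_of_mem hs)⟩
  obtain ⟨k, -, hk⟩ := hf 0 (Finset.mem_insert_self _ _)
  exact le_antisymm ((hmono (Nat.zero_le k)).trans_eq hk) zero_le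

/-- The law of a process whose increments are independent of the past is determined by its initial
law and by the laws of its increments. -/
theorem identDistrib_of_identDistrib_increments [IsProbabilityMeasure P']
    (hW : ∀ t, Measurable[𝓕 t] (W t)) (hW' : ∀ t, Measurable[𝓕' t] (W' t))
    (hind : ∀ s t : ℝ≥0, s ≤ t →
      Indep (𝓕 s) (MeasurableSpace.comap (fun ω => W t ω - W s ω) inferInstance) P)
    (hind' : ∀ s t : ℝ≥0, s ≤ t →
      Indep (𝓕' s) (MeasurableSpace.comap (fun ω => W' t ω - W' s ω) inferInstance) P')
    (h0 : IdentDistrib (W 0) (W' 0) P P')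
    (hinc : ∀ s t : ℝ≥0, s ≤ t →
      IdentDistrib (fun ω => W t ω - W s ω) (fun ω => W' t ω - W' s ω) P P') :
    IdentDistrib (fun ω t => W t ω) (fun ω t => W' t ω) P P' := by
  have hm : Measurable fun ω t => W t ω :=
    measurable_pi_iff.2 fun t => (hW t).mono (𝓕.le t) le_rfl
  have hm' : Measurable fun ω t => W' t ω :=
    measurable_pi_iff.2 fun t => (hW' t).mono (𝓕'.le t) le_rfl
  refine ⟨hm.aemeasurable, hm'.aemeasurable, ?_⟩
  have hfin (S : Finset ℝ≥0) :
      P.map (fun ω => S.restrict (W · ω)) = P'.map (fun ω => S.restrict (W' · ω)) := by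
    obtain ⟨τ, n, hτ, hτ0, hS⟩ := exists_monotone_seq_mem S
    choose k hkn hk using hS
    have hst := identDistrib_stopped hW hW' hind hind' h0 hinc hτ hτ0 n
    have := (hst.comp (u := fun (v : ℕ → E) (s : S) => v (k s.1 s.2)) (by fun_prop)).map_eq
    convert this using 2 <;>
    · ext ω s
      simp [min_eq_left (hkn s.1 s.2), hk s.1 s.2]
  have hlim := isProjectiveLimit_map hm.aemeasurable (P := P)
  simp_rw [hfin] at hlim
  exact hlim.unique (isProjectiveLimit_map hm'.aemeasurable)

end IncrementLaw

/-! ### Subvectors of Gaussian vectors and of Brownian motions -/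

section Gaussian

variable {ι κ : Type*} [Fintype ι] [DecidableEq ι] [Fintype κ] [DecidableEq κ]

lemma map_comp_multivariateGaussian {S : Matrix ι ι ℝ} (hS : S.PosSemidef)
    (m : EuclideanSpace ℝ ι) (e : κ → ι) :
    (multivariateGaussian m S).map (fun x => WithLp.toLp 2 fun k => x (e k)) =
      multivariateGaussian (WithLp.toLp 2 fun k => m (e k)) (S.submatrix e e) := by
  let g : EuclideanSpace ℝ ι →L[ℝ] EuclideanSpace ℝ κ := LinearMap.toContinuousLinearMap
    { toFun := fun x => WithLp.toLp 2 fun k => x (e k)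
      map_add' := fun _ _ => rfl
      map_smul' := fun _ _ => rfl }
  have hg : (fun x : EuclideanSpace ℝ ι => WithLp.toLp 2 fun k => x (e k)) = g := rfl
  rw [hg]
  apply IsGaussian.ext
  · simp only [id_eq, integral_id_multivariateGaussian]
    rw [ContinuousLinearMap.integral_id_map, integral_id_multivariateGaussian]
    · rfl
    · exact IsGaussian.integrable_id
  rw [← ContinuousLinearMap.toBilinForm_inj]
  refine LinearMap.BilinForm.ext_basis (EuclideanSpace.basisFun κ ℝ).toBasis fun i j => ?_
  rw [ContinuousLinearMap.toBilinForm_apply, ContinuousLinearMap.toBilinForm_apply,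
    covarianceBilin_apply_eq_cov, covariance_map]
  · have (i : κ) : (fun u => inner ℝ ((EuclideanSpace.basisFun κ ℝ).toBasis i) u) ∘ g =
        fun u => u (e i) := by ext; simp [PiLp.inner_apply, g]; rfl
    simp_rw [this, covariance_eval_multivariateGaussian hS,
      covarianceBilin_multivariateGaussian (hS.submatrix _)]
    simp
  any_goals exact Measurable.aestronglyMeasurable (by fun_prop)
  · fun_prop
  · exact IsGaussian.memLp_two_id

/-- A subvector of a Brownian motion is distributed, as a process, as every Brownian motion that has
the corresponding drift, covariance matrix and initial law. -/
lemma IsBrownianMotion.identDistrib_comp {Ω Ω' : Type*} [mΩ : MeasurableSpace Ω]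
    [mΩ' : MeasurableSpace Ω'] {P : Measure Ω} {P' : Measure Ω'} [IsProbabilityMeasure P]
    [IsProbabilityMeasure P'] {𝓕 : Filtration ℝ≥0 mΩ} {𝓕' : Filtration ℝ≥0 mΩ'} {μ : ι → ℝ}
    {A : Matrix ι ι ℝ} (hA : A.PosSemidef) {e : κ → ι} {B : ℝ≥0 → Ω → ι → ℝ}
    {B' : ℝ≥0 → Ω' → κ → ℝ} (hB : IsBrownianMotion P 𝓕 μ A B)
    (hB' : IsBrownianMotion P' 𝓕' (fun k => μ (e k)) (A.submatrix e e) B')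
    (h0 : IdentDistrib (fun ω k => B 0 ω (e k)) (B' 0) P P') :
    IdentDistrib (fun ω t k => B t ω (e k)) (fun ω t => B' t ω) P P' := by
  have hproj : Measurable fun (v : ι → ℝ) (k : κ) => v (e k) := by fun_prop
  refine identDistrib_of_identDistrib_increments (W := fun t ω k => B t ω (e k))
    (fun t => hproj.comp (hB.adapted t)) hB'.adapted ?_ hB'.indep_increment h0 ?_
  · intro s t hst
    refine indep_of_indep_of_le_right (hB.indep_increment s t hst) ?_
    have : (fun ω => (fun k => B t ω (e k)) - fun k => B s ω (e k)) =
        (fun (v : ι → ℝ) (k : κ) => v (e k)) ∘ fun ω => B t ω - B s ω := rfl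
    rw [this, ← MeasurableSpace.comap_comp]
    exact MeasurableSpace.comap_mono hproj.comap_le
  · intro s t hst
    have hpos : (((t : ℝ) - s) • A).PosSemidef := hA.smul (sub_nonneg.2 (by exact_mod_cast hst))
    have hg : Measurable fun x : EuclideanSpace ℝ ι =>
        (WithLp.toLp 2 fun k => x (e k) : EuclideanSpace ℝ κ) := by fun_prop
    have h1 := hB.law_increment s t hst
    have h2 : HasLaw (fun ω => WithLp.toLp 2 fun k => (B t ω - B s ω) (e k)) _ P :=
      HasLaw.comp (Y := fun x : EuclideanSpace ℝ ι =>
        (WithLp.toLp 2 fun k => x (e k) : EuclideanSpace ℝ κ))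
        ⟨hg.aemeasurable, map_comp_multivariateGaussian hpos _ e⟩ h1
    exact (h2.identDistrib (hB'.law_increment s t hst)).comp
      (u := (WithLp.ofLp : EuclideanSpace ℝ κ → κ → ℝ)) (by fun_prop)

end Gaussian

/-! ### Domination -/

/-- A lower bound on a continuous path, imposed at an arbitrary set of times, is equivalent to the
bound at countably many of them: the points of a countable dense subset of the graph of the bound
suffice. -/
lemma exists_countable_forall_le {K ι : Type*} [Finite ι] (τ : K → ℝ≥0) (i : K → ι) (y : K → ℝ) :
    ∃ D : Set K, D.Countable ∧ ∀ z : ℝ≥0 → ι → ℝ, Continuous z →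
      (∀ p ∈ D, y p ≤ z (τ p) (i p)) → ∀ p, y p ≤ z (τ p) (i p) := by
  let _ : TopologicalSpace ι := ⊥
  have : DiscreteTopology ι := ⟨rfl⟩
  let φ : K → ℝ≥0 × ι × ℝ := fun p => (τ p, i p, y p)
  let _ : TopologicalSpace K := TopologicalSpace.induced φ inferInstance
  have hφ : Topology.IsInducing φ := ⟨rfl⟩
  have : SecondCountableTopology K := hφ.secondCountableTopology
  obtain ⟨D, hD, hdense⟩ := TopologicalSpace.exists_countable_dense K
  refine ⟨D, hD, fun z hz hle p => ?_⟩
  have hτ : Continuous τ := continuous_fst.comp hφ.continuous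
  have hi : Continuous i := (continuous_fst.comp continuous_snd).comp hφ.continuous
  have hy : Continuous y := (continuous_snd.comp continuous_snd).comp hφ.continuous
  have hz2 : Continuous fun q : ℝ≥0 × ι => z q.1 q.2 :=
    continuous_prod_of_discrete_right.2 fun j => (continuous_apply j).comp hz
  have hcl : IsClosed {p | y p ≤ z (τ p) (i p)} := isClosed_le hy (hz2.comp (hτ.prodMk hi))
  exact hcl.closure_subset_iff.2 hle (hdense p)

/-- Domination for the components selected by an arbitrary injection `e`. Almost surely the
subsystem lies below all the approximate solutions driven by the subvector of its Brownian motion,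
the event that these exceed `y` depends only on the law of this subvector, and on the other
probability space the approximate solutions converge to `Z'`. -/
theorem processStochDominated_of_isSRBM {ι κ : Type*} [Fintype ι] [DecidableEq ι] [Fintype κ]
    [DecidableEq κ] {e : κ → ι} (he : Function.Injective e) {R A : Matrix ι ι ℝ} {μ : ι → ℝ}
    (hR : IsReflectionMMatrix R) (hA : A.PosSemidef)
    {Ω Ω' : Type*} [MeasurableSpace Ω] [MeasurableSpace Ω'] {P : Measure Ω} {P' : Measure Ω'}
    [IsProbabilityMeasure P] [IsProbabilityMeasure P']
    {Z : ℝ≥0 → Ω → ι → ℝ} {Z' : ℝ≥0 → Ω' → κ → ℝ} (hZ : IsSRBM P R μ A Z)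
    (hZ' : IsSRBM P' (R.submatrix e e) (fun k => μ (e k)) (A.submatrix e e) Z')
    (h0 : IdentDistrib (fun ω k => Z 0 ω (e k)) (Z' 0) P P') :
    ProcessStochDominated P P' (fun t ω k => Z t ω (e k)) Z' := by
  obtain ⟨Q, rfl, hQ, -, hsp⟩ := hR
  obtain ⟨𝓕, B, -, hB, -, hsol⟩ := hZ
  obtain ⟨𝓕', B', -, hB', -, hsol'⟩ := hZ'
  rw [Matrix.submatrix_sub, Pi.sub_apply, Pi.sub_apply, Matrix.submatrix_one e he] at hsol'
  -- The boundary terms vanish at time zero, so the Brownian motions start where the solutions do.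
  have hstart : IdentDistrib (fun ω k => B 0 ω (e k)) (B' 0) P P' := by
    have hm : Measurable (B 0) := (hB.adapted 0).mono (𝓕.le 0) le_rfl
    have hm' : Measurable (B' 0) := (hB'.adapted 0).mono (𝓕'.le 0) le_rfl
    have h1 : (fun ω k => B 0 ω (e k)) =ᵐ[P] fun ω k => Z 0 ω (e k) := by
      filter_upwards [hsol] with ω ⟨L, hL⟩
      simp [hL.eq_add 0, hL.bdry_zero]
    have h2 : B' 0 =ᵐ[P'] Z' 0 := by
      filter_upwards [hsol'] with ω ⟨L, hL⟩
      simp [hL.eq_add 0, hL.bdry_zero]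
    exact ((IdentDistrib.of_ae_eq (by fun_prop) h1).trans h0).trans
      (IdentDistrib.of_ae_eq hm'.aemeasurable h2).symm
  have hlaw := hB.identDistrib_comp hA hB' hstart
  intro T y
  obtain ⟨D, hD, hDy⟩ := exists_countable_forall_le (fun p : T × κ => (p.1 : ℝ≥0)) Prod.snd y
  let good : Set (ℝ≥0 → κ → ℝ) :=
    {x | ∀ n : ℕ, ∀ p ∈ D, y p ≤ reflIter (Q.submatrix e e) x n p.1 p.2}
  have hgood : MeasurableSet good := by
    have : good = ⋂ n : ℕ, ⋂ p ∈ D, {x | y p ≤ reflIter (Q.submatrix e e) x n p.1 p.2} := by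
      ext; simp [good]
    rw [this]
    exact MeasurableSet.iInter fun n => MeasurableSet.biInter hD fun p _ =>
      measurableSet_le measurable_const (measurable_reflIter _ n p.1 p.2)
  calc P {ω | y ≤ fun p : T × κ => Z p.1 ω (e p.2)}
      ≤ P ((fun ω t k => B t ω (e k)) ⁻¹' good) := by
        refine measure_mono_ae ?_
        filter_upwards [hsol] with ω ⟨L, hL⟩ hω n p _
        exact (hω p).trans (sol_le_reflIter hQ he hL n p.1 p.2)
    _ = P' ((fun ω t => B' t ω) ⁻¹' good) := hlaw.measure_mem_eq hgood
    _ ≤ P' {ω | y ≤ fun p : T × κ => Z' p.1 ω p.2} := by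
        refine measure_mono_ae ?_
        filter_upwards [hsol'] with ω ⟨L, hL⟩ hω
        refine hDy (fun t => Z' t ω) hL.continuous_sol fun p hp => ?_
        exact ge_of_tendsto' (tendsto_reflIter (fun _ _ => hQ _ _)
          (tendsto_submatrix_pow hQ hsp he) hL p.1 p.2) fun n => hω n p hp

end SRBM

theorem corollary3p6 {d : ℕ} (R A : Matrix (Fin d) (Fin d) ℝ) (μ : Fin d → ℝ)
    (hR : SRBM.IsReflectionMMatrix R) (hA : A.PosDef)
    (I : Finset (Fin d)) (hI : I.Nonempty)
    {Ω : Type*} [MeasurableSpace Ω] (P : Measure Ω) [IsProbabilityMeasure P]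
    {Ω' : Type*} [MeasurableSpace Ω'] (P' : Measure Ω') [IsProbabilityMeasure P']
    (Z : ℝ≥0 → Ω → Fin d → ℝ) (Zbar : ℝ≥0 → Ω' → Fin I.card → ℝ)
    (hZ : SRBM.IsSRBM P R μ A Z)
    (hZbar : SRBM.IsSRBM P' (SRBM.subMat I R) (SRBM.subVec I μ) (SRBM.subMat I A) Zbar)
    (h0 : IdentDistrib (fun ω => SRBM.subVec I (Z 0 ω)) (Zbar 0) P P') :
    SRBM.ProcessStochDominated P P' (fun t ω => SRBM.subVec I (Z t ω)) Zbar :=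
  SRBM.processStochDominated_of_isSRBM (I.orderEmbOfFin rfl).injective hR hA.posSemidef hZ hZbar h0
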